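/- For $n\ge 1$, let the symmetric group $S_n$ act on the set $C_2^n=\{0,1\}^n$ of binary $n$-tuples by permuting coordinates. The binary Burnside process on $C_2^n$ is the Markov chain with transition matrix $$K_n(x,y)=\frac{1}{|G_x|}\sum_{s\in G_x\cap G_y}\frac{1}{|X_s|},\qquad x,y\in C_2^n,$$ where $G_x=\{s\in S_n: s\cdot x=x\}$ and $X_s=\{z\in C_2^n: s\cdot z=z\}$. Its stationary distribution is $\pi_n(x)=\frac{1}{Z_n|\mathcal O_x|}$, where $\mathcal O_x$ is the $S_n$-orbit of $x$ and $Z_n=n+1$ is the number of orbits. For an integer $\ell\ge 0$, define the average chi-square distance to stationarity after $\ell$ steps by $$\chi^2_{\mathrm{avg},n}(\ell)=\sum_{x\in C_2^n}\pi_n(x)\sum_{y\in C_2^n}\frac{\bigl(K_n^\ell(x,y)-\pi_n(y)\bigr)^2}{\pi_n(y)}.$$ **Theorem 4.2.** For every $\varepsilon>0$ and every sequence $(\ell_n)$ of non-negative integers, the following hold as $n\to\infty$ ($\log$ is the natural logarithm). 1. If $\ell_n\le(1-\varepsilon)\,\frac{\log 2}{2}\,\frac{n}{\log n}$ for all sufficiently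 large $n$, then $\chi^2_{\mathrm{avg},n}(\ell_n)\to\infty$. 2. If $\ell_n\ge(1+\varepsilon)\,\frac{\log 2}{2}\,\frac{n}{\log n}$ for all sufficiently large $n$, then $\chi^2_{\mathrm{avg},n}(\ell_n)\to 0$. -/

import Mathlib

open Filter

noncomputable section

/-- Transition matrix of the Burnside process of a finite group `G` acting on a finite set `X`:
`K(x, y) = (1 / |G_x|) * ∑_{s ∈ G_x ∩ G_y} 1 / |X_s|`, where `G_x` is the stabilizer of `x` and
`X_s` is the set of points fixed by `s`. -/
def burnsideKernel (G X : Type*) [Group G] [Fintype G] [Fintype X] [DecidableEq X]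
    [MulAction G X] : Matrix X X ℝ :=
  Matrix.of fun x y =>
    1 / (Nat.card (MulAction.stabilizer G x) : ℝ) *
      ∑ s ∈ (Finset.univ : Finset G).filter (fun s => s • x = x ∧ s • y = y),
        1 / (Nat.card (MulAction.fixedBy X s) : ℝ)

/-- Stationary distribution of the Burnside process: `π(x) = 1 / (Z |O_x|)`, where `O_x` is the
orbit of `x` and `Z` is the number of orbits. -/
def burnsideStationary (G X : Type*) [Group G] [MulAction G X] (x : X) : ℝ :=
  1 / ((Nat.card (MulAction.orbitRel.Quotient G X) : ℝ) * (Nat.card (MulAction.orbit G x) : ℝ))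

/-- Chi-square distance after `l` steps of the chain `K` started at `x`, relative to `π`. -/
def chiSquare {X : Type*} [Fintype X] [DecidableEq X] (K : Matrix X X ℝ) (π : X → ℝ)
    (x : X) (l : ℕ) : ℝ :=
  ∑ y, ((K ^ l) x y - π y) ^ 2 / π y

/-- Average chi-square distance after `l` steps, the starting state being weighted by `π`. -/
def chiSquareAvg {X : Type*} [Fintype X] [DecidableEq X] (K : Matrix X X ℝ) (π : X → ℝ)
    (l : ℕ) : ℝ :=
  ∑ x, π x * chiSquare K π x l

/-- The set `C_2^n` of binary `n`-tuples. -/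
abbrev BinaryTuple (n : ℕ) : Type := Fin n → Bool

/-- The symmetric group `S_n` acts on binary `n`-tuples by permuting coordinates:
`(s • x) i = x (s⁻¹ i)`. -/
instance binaryTupleAction (n : ℕ) : MulAction (Equiv.Perm (Fin n)) (BinaryTuple n) where
  smul s x := fun i => x (s⁻¹ i)
  one_smul _ := rfl
  mul_smul s t x := by
    funext i
    change x ((s * t)⁻¹ i) = x (t⁻¹ (s⁻¹ i))
    rw [mul_inv_rev, Equiv.Perm.mul_apply]

/-- Average chi-square distance to stationarity of the binary Burnside process on `C_2^n` after
`l` steps. -/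
def binaryBurnsideChiSquareAvg (n l : ℕ) : ℝ :=
  chiSquareAvg (burnsideKernel (Equiv.Perm (Fin n)) (BinaryTuple n))
    (burnsideStationary (Equiv.Perm (Fin n)) (BinaryTuple n)) l

end

/-! The chain is reversible, so the average chi-square distance is `(K ^ (2 * l)).trace - 1`
(`chiSquareAvg_eq_trace`), and only the spectrum of `K` matters.

To find it, apply `K` to the Walsh function of `t`. Its mean over the tuples fixed by `s` is 1 if
every cycle of `s` meets the support of `t` in an even number of points, and 0 otherwise. The
stabilizer of `x` is a product of two symmetric groups, one per colour, and each induces a uniform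
permutation on the part of the support in its colour class. Hence `K` sends the function to a
product of two values of `evenCycleProb` (`sum_burnsideKernel_mul_walsh`). In the Walsh basis `K` is
therefore triangular for inclusion of supports, and a binomial identity gives the diagonal entry
`evenCycleProb j ^ 2` for a support of size `j`. So `K` has this eigenvalue with multiplicity
`n.choose j` (`trace_burnsideKernel_pow`).

The eigenvalue vanishes for odd `j` and lies between `1 / (2 * j)` and `1 / (j + 1)` for even `j >
0`. The distance is then governed by the roughly `2 ^ n` eigenvalues of size about `1 / n`, and `2 ^
n * n ^ (-2 * l)` changes regime at the stated cutoff. -/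

/-! ### Burnside processes: stationary law and reversibility. -/

section BurnsideProcess

variable {G X : Type*} [Group G] [MulAction G X]

theorem natCard_fixedBy [Fintype X] [DecidableEq X] (s : G) :
    Nat.card (MulAction.fixedBy X s) = (Finset.univ.filter fun y : X => s • y = y).card := by
  rw [Nat.card_eq_fintype_card, ← Set.toFinset_card]
  congr 1
  ext y
  simp

theorem natCard_stabilizer [Fintype G] [DecidableEq X] (x : X) :
    Nat.card (MulAction.stabilizer G x) = (Finset.univ.filter fun s : G => s • x = x).card := by
  classical
  rw [Nat.card_eq_fintype_card]
  exact Fintype.card_of_subtype _ (by simp)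

theorem natCard_stabilizer_pos [Fintype G] (x : X) :
    (0 : ℝ) < Nat.card (MulAction.stabilizer G x) := by
  exact_mod_cast Nat.card_pos

/-- One step picks `s` uniformly in the stabilizer of `x`, then a uniform point fixed by `s`.
Exchanging the two sums exposes this. -/
theorem sum_burnsideKernel_mul [Fintype G] [Fintype X] [DecidableEq X] (x : X) (f : X → ℝ) :
    ∑ y, burnsideKernel G X x y * f y =
      1 / (Nat.card (MulAction.stabilizer G x) : ℝ) *
        ∑ s ∈ Finset.univ.filter (fun s : G => s • x = x),
          (∑ y ∈ Finset.univ.filter (fun y : X => s • y = y), f y) /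
            (Finset.univ.filter fun y : X => s • y = y).card := by
  simp only [burnsideKernel, Matrix.of_apply, natCard_fixedBy, mul_assoc, Finset.sum_mul,
    ← Finset.mul_sum, Finset.sum_div]
  congr 1
  simp only [Finset.sum_filter, ite_and]
  rw [Finset.sum_comm]
  refine Finset.sum_congr rfl fun s _ => ?_
  by_cases hs : s • x = x
  · simp only [hs, if_true]
    refine Finset.sum_congr rfl fun y _ => ?_
    split_ifs <;> ring
  · simp [hs]

theorem sum_burnsideKernel [Fintype G] [Fintype X] [DecidableEq X] (x : X) :
    ∑ y, burnsideKernel G X x y = 1 := by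
  have h := sum_burnsideKernel_mul (G := G) x (fun _ => 1)
  simp only [mul_one] at h
  rw [h, natCard_stabilizer]
  have h1 : ∀ s ∈ Finset.univ.filter (fun s : G => s • x = x),
      (∑ y ∈ Finset.univ.filter (fun y : X => s • y = y), (1 : ℝ)) /
            (Finset.univ.filter fun y : X => s • y = y).card = 1 := by
    intro s hs
    rw [Finset.sum_const, nsmul_eq_mul, mul_one]
    refine div_self ?_
    have : x ∈ Finset.univ.filter fun y : X => s • y = y := by simpa using hs
    exact_mod_cast (Finset.card_pos.2 ⟨x, this⟩).ne'
  rw [Finset.sum_congr rfl h1, Finset.sum_const, nsmul_eq_mul, mul_one]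
  refine one_div_mul_cancel ?_
  have := natCard_stabilizer_pos (G := G) x
  rw [natCard_stabilizer] at this
  exact this.ne'

theorem burnsideStationary_eq [Fintype G] (x : X) :
    burnsideStationary G X x = (Nat.card (MulAction.stabilizer G x) : ℝ) /
      ((Nat.card (MulAction.orbitRel.Quotient G X) : ℝ) * Nat.card G) := by
  have h : Nat.card (MulAction.stabilizer G x) * Nat.card (MulAction.orbit G x) = Nat.card G := by
    rw [Nat.card_coe_set_eq, ← MulAction.index_stabilizer, Subgroup.card_mul_index]
  have h0 : (Nat.card (MulAction.stabilizer G x) : ℝ) ≠ 0 := (natCard_stabilizer_pos x).ne'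
  rw [burnsideStationary, ← h]
  push_cast
  field_simp

theorem natCard_orbits_pos [Fintype X] [Nonempty X] :
    (0 : ℝ) < Nat.card (MulAction.orbitRel.Quotient G X) := by
  have : Nonempty (MulAction.orbitRel.Quotient G X) :=
    ‹Nonempty X›.map (Quotient.mk (MulAction.orbitRel G X))
  have : Finite (MulAction.orbitRel.Quotient G X) := Quotient.finite _
  exact_mod_cast Nat.card_pos

theorem burnsideStationary_pos [Fintype G] [Fintype X] (x : X) : 0 < burnsideStationary G X x := by
  have : Nonempty X := ⟨x⟩
  rw [burnsideStationary_eq]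
  have h1 := natCard_stabilizer_pos (G := G) x
  have h2 := natCard_orbits_pos (G := G) (X := X)
  have h3 : (0 : ℝ) < Nat.card G := by exact_mod_cast Nat.card_pos
  positivity

/-- By orbit-stabilizer this is Burnside's orbit-counting lemma, after counting the pairs `s • x =
x` in the other order. -/
theorem sum_burnsideStationary [Fintype G] [Fintype X] [Nonempty X] :
    ∑ x, burnsideStationary G X x = 1 := by
  classical
  have h2 := natCard_orbits_pos (G := G) (X := X)
  have h3 : (0 : ℝ) < Nat.card G := by exact_mod_cast Nat.card_pos
  simp only [burnsideStationary_eq, ← Finset.sum_div]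
  rw [div_eq_one_iff_eq (by positivity)]
  have : Fintype (MulAction.orbitRel.Quotient G X) := Fintype.ofFinite _
  have hb := MulAction.sum_card_fixedBy_eq_card_orbits_mul_card_group G X
  rw [← Nat.card_eq_fintype_card, ← Nat.card_eq_fintype_card (α := G)] at hb
  rw [← Nat.cast_mul, ← hb]
  simp only [← Nat.card_eq_fintype_card, natCard_fixedBy, natCard_stabilizer,
    Finset.card_filter]
  push_cast
  exact Finset.sum_comm

theorem burnsideKernel_reversible [Fintype G] [Fintype X] [DecidableEq X] (x y : X) :
    burnsideStationary G X x * burnsideKernel G X x y =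
      burnsideStationary G X y * burnsideKernel G X y x := by
  have hx := (natCard_stabilizer_pos (G := G) x).ne'
  have hy := (natCard_stabilizer_pos (G := G) y).ne'
  simp only [burnsideStationary_eq, burnsideKernel, Matrix.of_apply,
    and_comm (a := _ • y = y) (b := _ • x = x)]
  rw [← mul_assoc, ← mul_assoc]
  congr 1
  field_simp

end BurnsideProcess

/-! ### Reversible chains: chi-square distance as a trace. -/

section Reversible

variable {X : Type*} [Fintype X] [DecidableEq X] {K : Matrix X X ℝ} {π : X → ℝ}

theorem pow_reversible (hrev : ∀ x y, π x * K x y = π y * K y x) (l : ℕ) (x y : X) :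
    π x * (K ^ l) x y = π y * (K ^ l) y x := by
  induction l generalizing x y with
  | zero =>
    by_cases h : x = y
    · rw [h]
    · simp [h, Ne.symm h]
  | succ l ih =>
    -- The left power is split at its last step and the right one at its first, so that the
    -- intermediate states match.
    rw [pow_succ, Matrix.mul_apply, ← pow_succ, pow_succ', Matrix.mul_apply, Finset.mul_sum,
      Finset.mul_sum]
    refine Finset.sum_congr rfl fun z _ => ?_
    rw [← mul_assoc, ih, mul_right_comm, hrev, mul_assoc]

theorem sum_pow_apply (hsum : ∀ x, ∑ y, K x y = 1) (l : ℕ) (x : X) : ∑ y, (K ^ l) x y = 1 := by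
  induction l generalizing x with
  | zero => simp [Matrix.one_apply]
  | succ l ih =>
    simp only [pow_succ, Matrix.mul_apply]
    rw [Finset.sum_comm]
    simp only [← Finset.mul_sum, hsum, mul_one, ih]

/-- The average chi-square distance of a reversible chain is a trace. -/
theorem chiSquareAvg_eq_trace (hpos : ∀ x, 0 < π x) (hπ : ∑ x, π x = 1)
    (hsum : ∀ x, ∑ y, K x y = 1) (hrev : ∀ x y, π x * K x y = π y * K y x) (l : ℕ) :
    chiSquareAvg K π l = (K ^ (2 * l)).trace - 1 := by
  -- Reversibility turns the square term into a summand of the trace of `K ^ l * K ^ l`; the other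
  -- two terms sum to `-2` and `1`.
  have key : ∀ x y, π x * (((K ^ l) x y - π y) ^ 2 / π y) =
      (K ^ l) x y * (K ^ l) y x - 2 * (π x * (K ^ l) x y) + π x * π y := by
    intro x y
    have hy := (hpos y).ne'
    have h := pow_reversible hrev l x y
    have h' : π x * (((K ^ l) x y - π y) ^ 2 / π y) =
      (K ^ l) x y * (π x * (K ^ l) x y) / π y - 2 * (π x * (K ^ l) x y) + π x * π y := by
      field_simp
      ring
    rw [h', h]
    field_simp
  simp only [chiSquareAvg, chiSquare, Finset.mul_sum, key, Finset.sum_add_distrib,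
    Finset.sum_sub_distrib, two_mul l, pow_add, Matrix.trace, Matrix.diag, Matrix.mul_apply]
  simp only [← Finset.mul_sum, sum_pow_apply hsum, mul_one, hπ]
  ring

end Reversible

theorem binaryBurnsideChiSquareAvg_eq_trace (n l : ℕ) :
    binaryBurnsideChiSquareAvg n l =
      (burnsideKernel (Equiv.Perm (Fin n)) (BinaryTuple n) ^ (2 * l)).trace - 1 :=
  chiSquareAvg_eq_trace burnsideStationary_pos sum_burnsideStationary sum_burnsideKernel
    burnsideKernel_reversible l

/-! ### Action of the kernel on Walsh functions. -/

section Walsh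

variable {n : ℕ}

/-- The sign `(-1) ^ b`. -/
def boolSign (b : Bool) : ℝ := if b then -1 else 1

/-- The Walsh function `y ↦ (-1) ^ #{i | t i ∧ y i}`. -/
def walsh (t y : Fin n → Bool) : ℝ := ∏ i, boolSign (t i && y i)

/-- The number of `i` with `t i = true` and `x i = c`. -/
def overlap (t x : Fin n → Bool) (c : Bool) : ℕ := ∑ i, if t i = true ∧ x i = c then 1 else 0

/-- Negation of the coordinate `i`. -/
def flipAt (i : Fin n) (t : Fin n → Bool) : Fin n → Bool := Function.update t i (!t i)

/-- The probability that all cycles of a uniform permutation of `m` points have even length. -/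
noncomputable def evenCycleProb : ℕ → ℝ
  | 0 => 1
  | 1 => 0
  | m + 2 => (m + 1) / (m + 2) * evenCycleProb m

theorem evenCycleProb_succ_mul (m : ℕ) :
    (m + 1) * evenCycleProb (m + 1) = m * evenCycleProb (m - 1) := by
  -- At `m = 0` the truncated index `m - 1` is harmless, since its coefficient is zero.
  cases m with
  | zero => simp [evenCycleProb]
  | succ m =>
    rw [evenCycleProb]
    push_cast
    have : (m : ℝ) + 2 ≠ 0 := by positivity
    field_simp
    ring

theorem flipAt_flipAt (i : Fin n) (t : Fin n → Bool) : flipAt i (flipAt i t) = t := by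
  simp [flipAt]

theorem sum_flipAt (i : Fin n) (F : (Fin n → Bool) → ℝ) : ∑ x, F (flipAt i x) = ∑ x, F x :=
  Equiv.sum_comp (Function.Involutive.toPerm (flipAt i) (flipAt_flipAt i)) F

theorem walsh_comm (t y : Fin n → Bool) : walsh t y = walsh y t := by
  simp only [walsh, Bool.and_comm]

theorem walsh_cons (c b : Bool) (t y : Fin n → Bool) :
    walsh (Fin.cons c t : Fin (n + 1) → Bool) (Fin.cons b y : Fin (n + 1) → Bool) =
      boolSign (c && b) * walsh t y := by
  simp [walsh, Fin.prod_univ_succ]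

theorem walsh_flipAt (i : Fin n) (t y : Fin n → Bool) :
    walsh (flipAt i t) y = boolSign (y i) * walsh t y := by
  have h : ∀ j, boolSign (flipAt i t j && y j) =
      (if j = i then boolSign (y j) else 1) * boolSign (t j && y j) := by
    intro j
    by_cases hj : j = i
    · subst hj
      cases h1 : t j <;> cases h2 : y j <;> simp [flipAt, boolSign, h1]
    · simp [flipAt, hj]
  simp only [walsh, h, Finset.prod_mul_distrib, Finset.prod_ite_eq', Finset.mem_univ, if_true]

theorem overlap_cons (c b a : Bool) (t x : Fin n → Bool) :
    overlap (Fin.cons c t : Fin (n + 1) → Bool) (Fin.cons b x : Fin (n + 1) → Bool) a =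
      (if c = true ∧ b = a then 1 else 0) + overlap t x a := by
  simp only [overlap, Fin.sum_univ_succ, Fin.cons_zero, Fin.cons_succ]

theorem overlap_flipAt_of_ne {i : Fin n} {t x : Fin n → Bool} {c : Bool} (h : x i ≠ c) :
    overlap (flipAt i t) x c = overlap t x c := by
  refine Finset.sum_congr rfl fun j _ => ?_
  by_cases hj : j = i
  · subst hj
    simp [h]
  · simp [flipAt, hj]

theorem overlap_flipAt_of_false {i : Fin n} {t x : Fin n → Bool} {c : Bool} (h : x i = c)
    (ht : t i = false) : overlap (flipAt i t) x c = overlap t x c + 1 := by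
  have h1 : ∀ j, (if flipAt i t j = true ∧ x j = c then 1 else 0) =
      (if t j = true ∧ x j = c then 1 else 0) + if j = i then 1 else 0 := by
    intro j
    by_cases hj : j = i
    · subst hj
      simp [h, flipAt, ht]
    · simp [flipAt, hj]
  simp only [overlap, h1, Finset.sum_add_distrib, Finset.sum_ite_eq', Finset.mem_univ, if_true]

theorem overlap_flipAt_of_true {i : Fin n} {t x : Fin n → Bool} {c : Bool} (h : x i = c)
    (ht : t i = true) : overlap (flipAt i t) x c = overlap t x c - 1 := by
  have := overlap_flipAt_of_false (t := flipAt i t) h (by simp [flipAt, ht])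
  rw [flipAt_flipAt] at this
  omega

theorem sum_bool_cons (F : (Fin (n + 1) → Bool) → ℝ) :
    ∑ y, F y = ∑ y : Fin n → Bool, (F (Fin.cons false y) + F (Fin.cons true y)) := by
  rw [← Equiv.sum_comp (Fin.consEquiv fun _ => Bool), Fintype.sum_prod_type, Fintype.sum_bool,
    Finset.sum_add_distrib, add_comm]
  rfl

theorem sum_perm_decomposeFin (F : Equiv.Perm (Fin (n + 1)) → ℝ) :
    ∑ s, F s = ∑ e : Equiv.Perm (Fin n), F (Equiv.Perm.decomposeFin.symm (0, e)) +
      ∑ i : Fin n, ∑ e : Equiv.Perm (Fin n), F (Equiv.Perm.decomposeFin.symm (i.succ, e)) := by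
  rw [← Equiv.sum_comp Equiv.Perm.decomposeFin.symm, Fintype.sum_prod_type, Fin.sum_univ_succ]

theorem cons_comp_decomposeFin_zero (b : Bool) (y : Fin n → Bool) (e : Equiv.Perm (Fin n)) :
    (Fin.cons b y : Fin (n + 1) → Bool) ∘ Equiv.Perm.decomposeFin.symm (0, e) = Fin.cons b y ↔
      y ∘ e = y := by
  simp [funext_iff, Fin.forall_fin_succ]

/-- Here the new point 0 is inserted into the cycle of `e` through `i`, just before `i`, so
invariance forces it to share the colour of `i`. -/
theorem cons_comp_decomposeFin_succ (b : Bool) (y : Fin n → Bool) (e : Equiv.Perm (Fin n))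
    (i : Fin n) :
    (Fin.cons b y : Fin (n + 1) → Bool) ∘ Equiv.Perm.decomposeFin.symm (i.succ, e) =
      Fin.cons b y ↔ y i = b ∧ y ∘ e = y := by
  simp only [funext_iff, Fin.forall_fin_succ, Function.comp_apply,
    Equiv.Perm.decomposeFin_symm_apply_zero, Equiv.Perm.decomposeFin_symm_apply_succ,
    Fin.cons_zero, Fin.cons_succ]
  refine and_congr_right fun hb => forall_congr' fun j => ?_
  by_cases hj : e j = i
  · rw [hj, Equiv.swap_apply_right, Fin.cons_zero, hb]
  · rw [Equiv.swap_apply_of_ne_of_ne (Fin.succ_ne_zero _) (by simpa using hj), Fin.cons_succ]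

/-- The sum of the Walsh function of `t` over the tuples fixed by `s`. -/
def fixedWalshSum (s : Equiv.Perm (Fin n)) (t : Fin n → Bool) : ℝ :=
  ∑ y : Fin n → Bool, if y ∘ s = y then walsh t y else 0

/-- The mean of the Walsh function of `t` over the tuples fixed by `s`. -/
noncomputable def fixedWalshMean (s : Equiv.Perm (Fin n)) (t : Fin n → Bool) : ℝ :=
  fixedWalshSum s t / (Finset.univ.filter fun y : Fin n → Bool => y ∘ s = y).card

/-- Makes the denominator of `fixedWalshMean` a Walsh sum, so the same recursions serve numerator
and denominator. -/
theorem fixedWalshSum_const_false (s : Equiv.Perm (Fin n)) :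
    fixedWalshSum s (fun _ => false) =
      (Finset.univ.filter fun y : Fin n → Bool => y ∘ s = y).card := by
  simp [fixedWalshSum, walsh, boolSign]

theorem fixedWalshSum_decomposeFin_zero (e : Equiv.Perm (Fin n)) (c : Bool) (t : Fin n → Bool) :
    fixedWalshSum (Equiv.Perm.decomposeFin.symm (0, e)) (Fin.cons c t : Fin (n + 1) → Bool) =
      (if c then 0 else 2) * fixedWalshSum e t := by
  rw [fixedWalshSum, sum_bool_cons, fixedWalshSum, Finset.mul_sum]
  refine Finset.sum_congr rfl fun y _ => ?_
  simp only [cons_comp_decomposeFin_zero, walsh_cons]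
  cases c <;> split_ifs <;> simp_all [boolSign, two_mul]

/-- On fixed tuples the new coordinate equals `y i`; if it belongs to the support, its sign is
absorbed by toggling `i` in `t`. -/
theorem fixedWalshSum_decomposeFin_succ (e : Equiv.Perm (Fin n)) (i : Fin n) (c : Bool)
    (t : Fin n → Bool) :
    fixedWalshSum (Equiv.Perm.decomposeFin.symm (i.succ, e)) (Fin.cons c t : Fin (n + 1) → Bool) =
      fixedWalshSum e (if c then flipAt i t else t) := by
  rw [fixedWalshSum, sum_bool_cons, fixedWalshSum]
  refine Finset.sum_congr rfl fun y _ => ?_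
  simp only [cons_comp_decomposeFin_succ, walsh_cons]
  cases c
  · cases h : y i <;> simp [boolSign]
  · cases h : y i <;> simp [walsh_flipAt, h]

theorem cons_const_false :
    (fun _ => false : Fin (n + 1) → Bool) = Fin.cons false (fun _ => false) := by
  funext i
  refine Fin.cases ?_ (fun j => ?_) i <;> simp

theorem fixedWalshMean_decomposeFin_zero (e : Equiv.Perm (Fin n)) (c : Bool) (t : Fin n → Bool) :
    fixedWalshMean (Equiv.Perm.decomposeFin.symm (0, e)) (Fin.cons c t : Fin (n + 1) → Bool) =
      if c then 0 else fixedWalshMean e t := by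
  rw [fixedWalshMean, ← fixedWalshSum_const_false, cons_const_false,
    fixedWalshSum_decomposeFin_zero, fixedWalshSum_decomposeFin_zero, fixedWalshMean,
    ← fixedWalshSum_const_false]
  cases c
  · simp [mul_div_mul_left]
  · simp

theorem fixedWalshMean_decomposeFin_succ (e : Equiv.Perm (Fin n)) (i : Fin n) (c : Bool)
    (t : Fin n → Bool) :
    fixedWalshMean (Equiv.Perm.decomposeFin.symm (i.succ, e)) (Fin.cons c t : Fin (n + 1) → Bool) =
      fixedWalshMean e (if c then flipAt i t else t) := by
  rw [fixedWalshMean, ← fixedWalshSum_const_false, cons_const_false,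
    fixedWalshSum_decomposeFin_succ, fixedWalshSum_decomposeFin_succ, fixedWalshMean,
    ← fixedWalshSum_const_false]
  simp

/-- The number of coordinates `i` with `x i = a`. -/
def colourCount (x : Fin n → Bool) (a : Bool) : ℕ := ∑ i, if x i = a then 1 else 0

theorem sum_stabilizer_cons (a : Bool) (x : Fin n → Bool)
    (F : Equiv.Perm (Fin (n + 1)) → ℝ) :
    (∑ s : Equiv.Perm (Fin (n + 1)), if (Fin.cons a x : Fin (n + 1) → Bool) ∘ s = Fin.cons a x
        then F s else 0) =
      (∑ e : Equiv.Perm (Fin n), if x ∘ e = x then F (Equiv.Perm.decomposeFin.symm (0, e)) else 0) +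
      ∑ i : Fin n, if x i = a then ∑ e : Equiv.Perm (Fin n), if x ∘ e = x then
        F (Equiv.Perm.decomposeFin.symm (i.succ, e)) else 0 else 0 := by
  simp only [sum_perm_decomposeFin, cons_comp_decomposeFin_zero, cons_comp_decomposeFin_succ,
    ite_and]
  congr 1
  refine Finset.sum_congr rfl fun i _ => ?_
  split_ifs <;> simp

theorem card_stabilizer_cons (a : Bool) (x : Fin n → Bool) :
    ((Finset.univ.filter fun s : Equiv.Perm (Fin (n + 1)) =>
        (Fin.cons a x : Fin (n + 1) → Bool) ∘ s = Fin.cons a x).card : ℝ) =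
      (1 + colourCount x a) *
        (Finset.univ.filter fun s : Equiv.Perm (Fin n) => x ∘ s = x).card := by
  simp only [Finset.card_filter, colourCount]
  push_cast
  rw [sum_stabilizer_cons, add_mul, one_mul, Finset.sum_mul]
  simp

/-- With `m` support points in a class of size `N`, the sum has `m` terms at `m - 1` and `N - m`
terms at `m + 1`; `evenCycleProb_succ_mul` converts the former into the latter. -/
theorem sum_colour_flipAt (x t : Fin n → Bool) (a : Bool) :
    (∑ i, if x i = a then evenCycleProb (overlap (flipAt i t) x a) else 0) =
      (1 + colourCount x a) * evenCycleProb (overlap t x a + 1) := by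
  have h1 : ∀ i, (if x i = a then evenCycleProb (overlap (flipAt i t) x a) else 0) =
      (if x i = a then (1 : ℝ) else 0) * evenCycleProb (overlap t x a + 1) +
      (if t i = true ∧ x i = a then (1 : ℝ) else 0) *
        (evenCycleProb (overlap t x a - 1) - evenCycleProb (overlap t x a + 1)) := by
    intro i
    by_cases hx : x i = a
    · cases ht : t i
      · simp [hx, overlap_flipAt_of_false hx ht]
      · simp [hx, overlap_flipAt_of_true hx ht]
    · simp [hx]
  have h2 : (∑ i, if t i = true ∧ x i = a then (1 : ℝ) else 0) = overlap t x a := by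
    simp [overlap]
  have h3 : (∑ i, if x i = a then (1 : ℝ) else 0) = colourCount x a := by
    simp [colourCount]
  simp only [h1, Finset.sum_add_distrib, ← Finset.sum_mul, h2, h3]
  have := evenCycleProb_succ_mul (overlap t x a)
  linarith

/-- The mean over the stabilizer of `x` of the mean of a Walsh function over fixed points. -/
theorem sum_stabilizer_fixedWalshMean (x t : Fin n → Bool) :
    (∑ s : Equiv.Perm (Fin n), if x ∘ s = x then fixedWalshMean s t else 0) =
      (Finset.univ.filter fun s : Equiv.Perm (Fin n) => x ∘ s = x).card *
        (evenCycleProb (overlap t x false) * evenCycleProb (overlap t x true)) := by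
  induction n with
  | zero =>
    have : ∀ s : Equiv.Perm (Fin 0), x ∘ s = x := fun s => Subsingleton.elim _ _
    have h' : ∀ (s : Equiv.Perm (Fin 0)) (y : Fin 0 → Bool), y ∘ s = y :=
      fun s y => Subsingleton.elim _ _
    simp [this, h', fixedWalshMean, fixedWalshSum, walsh, overlap, evenCycleProb]
  | succ n ih =>
    obtain ⟨a, x, rfl⟩ : ∃ a x', x = (Fin.cons a x' : Fin (n + 1) → Bool) :=
      ⟨x 0, Fin.tail x, (Fin.cons_self_tail x).symm⟩
    obtain ⟨c, t, rfl⟩ : ∃ c t', t = (Fin.cons c t' : Fin (n + 1) → Bool) :=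
      ⟨t 0, Fin.tail t, (Fin.cons_self_tail t).symm⟩
    rw [sum_stabilizer_cons, card_stabilizer_cons]
    simp only [fixedWalshMean_decomposeFin_zero, fixedWalshMean_decomposeFin_succ, overlap_cons]
    -- If the new point lies outside the support, all its insertions give the same mean. If it lies
    -- inside, leaving it as a fixed point contributes 0, and the insertions are summed by
    -- `sum_colour_flipAt`.
    cases c
    · simp only [Bool.false_eq_true, if_false, false_and, zero_add, ih, ← Finset.sum_filter,
        Finset.sum_const, nsmul_eq_mul]
      simp only [colourCount, Finset.card_filter]
      ring
    · simp only [if_true, ite_self, Finset.sum_const_zero, zero_add, ih, true_and]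
      have key := sum_colour_flipAt x t a
      set N : ℝ := ((Finset.univ.filter fun s : Equiv.Perm (Fin n) => x ∘ s = x).card : ℝ)
      have h : ∀ i, (if x i = a then N * (evenCycleProb (overlap (flipAt i t) x false) *
          evenCycleProb (overlap (flipAt i t) x true)) else 0) =
          N * evenCycleProb (overlap t x (!a)) *
            (if x i = a then evenCycleProb (overlap (flipAt i t) x a) else 0) := by
        intro i
        by_cases hx : x i = a
        · rw [if_pos hx, if_pos hx]
          have : overlap (flipAt i t) x (!a) = overlap t x (!a) :=
            overlap_flipAt_of_ne (by simp [hx])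
          cases a
          · rw [← this]
            simp only [Bool.not_false]
            ring
          · rw [← this]
            simp only [Bool.not_true]
            ring
        · rw [if_neg hx, if_neg hx, mul_zero]
      simp only [h, ← Finset.mul_sum, key]
      cases a
      · simp [add_comm 1]
        ring
      · simp [add_comm 1]
        ring

theorem perm_smul_eq_iff (s : Equiv.Perm (Fin n)) (y : BinaryTuple n) : s • y = y ↔ y ∘ s = y := by
  constructor
  · intro h
    funext i
    have := congrFun h (s i)
    change y (s⁻¹ (s i)) = y (s i) at this
    simpa using this.symm
  · intro h
    funext i
    have := congrFun h (s⁻¹ i)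
    change y (s⁻¹ i) = y i
    simpa using this.symm

/-- The Burnside kernel applied to a Walsh function. -/
theorem sum_burnsideKernel_mul_walsh (x t : BinaryTuple n) :
    ∑ y, burnsideKernel (Equiv.Perm (Fin n)) (BinaryTuple n) x y * walsh y t =
      evenCycleProb (overlap t x false) * evenCycleProb (overlap t x true) := by
  have hpos := (natCard_stabilizer_pos (G := Equiv.Perm (Fin n)) x).ne'
  rw [sum_burnsideKernel_mul]
  rw [natCard_stabilizer] at hpos ⊢
  simp only [perm_smul_eq_iff, walsh_comm _ t] at hpos ⊢
  have := sum_stabilizer_fixedWalshMean x t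
  simp only [fixedWalshMean, fixedWalshSum, ← Finset.sum_filter] at this
  rw [this]
  field_simp

end Walsh

/-! ### Closed form and binomial convolution of the even-cycle probabilities. -/

theorem evenCycleProb_odd (k : ℕ) : evenCycleProb (2 * k + 1) = 0 := by
  induction k with
  | zero => rfl
  | succ k ih => rw [show 2 * (k + 1) + 1 = 2 * k + 1 + 2 by ring, evenCycleProb, ih, mul_zero]

theorem evenCycleProb_even (k : ℕ) :
    evenCycleProb (2 * k) = (Nat.centralBinom k : ℝ) / 4 ^ k := by
  induction k with
  | zero => simp [evenCycleProb]
  | succ k ih =>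
    have h : ((k : ℝ) + 1) * Nat.centralBinom (k + 1) = 2 * (2 * k + 1) * Nat.centralBinom k := by
      exact_mod_cast Nat.succ_mul_centralBinom_succ k
    have h1 : (Nat.centralBinom (k + 1) : ℝ) =
        2 * (2 * k + 1) * Nat.centralBinom k / (k + 1) := by
      field_simp
      linarith
    rw [show 2 * (k + 1) = 2 * k + 2 by ring, evenCycleProb, ih, h1]
    push_cast
    field_simp
    ring

theorem choose_mul_centralBinom (i j : ℕ) :
    (2 * (i + j)).choose (2 * i) * (Nat.centralBinom i * Nat.centralBinom j) =
      Nat.centralBinom (i + j) * (i + j).choose i ^ 2 := by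
  have h1 := Nat.add_choose_mul_factorial_mul_factorial (2 * i) (2 * j)
  have h2 := Nat.add_choose_mul_factorial_mul_factorial i j
  have h3 := Nat.add_choose_mul_factorial_mul_factorial i i
  have h4 := Nat.add_choose_mul_factorial_mul_factorial j j
  have h5 := Nat.add_choose_mul_factorial_mul_factorial (i + j) (i + j)
  rw [← Nat.choose_symm_add] at h1 h2
  rw [Nat.centralBinom, Nat.centralBinom, Nat.centralBinom]
  rw [← two_mul] at h3 h4 h5
  rw [← mul_add] at h1
  have hpos : 0 < (i.factorial * i.factorial) * (j.factorial * j.factorial) := by positivity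
  refine Nat.eq_of_mul_eq_mul_right hpos ?_
  calc _ = (2 * (i + j)).choose (2 * i) * ((2 * i).choose i * i.factorial * i.factorial) *
        ((2 * j).choose j * j.factorial * j.factorial) := by ring
    _ = (2 * (i + j)).choose (i + j) * ((i + j).choose i * i.factorial * j.factorial) *
        ((i + j).choose i * i.factorial * j.factorial) := by rw [h3, h4, h1, h2, h5]
    _ = _ := by ring

/-- For odd `m` every summand has an odd index. For `m = 2 * k` only even `j` survive, and
`choose_mul_centralBinom` reduces the sum to that of the squares `(k.choose i) ^ 2`, which is
`Nat.centralBinom k`. -/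
theorem sum_choose_mul_evenCycleProb (m : ℕ) :
    ∑ j ∈ Finset.range (m + 1), (m.choose j : ℝ) * (evenCycleProb j * evenCycleProb (m - j)) =
      2 ^ m * evenCycleProb m ^ 2 := by
  obtain ⟨k, rfl | rfl⟩ := Nat.even_or_odd' m
  · have h1 : ∑ j ∈ Finset.range (2 * k + 1),
        ((2 * k).choose j : ℝ) * (evenCycleProb j * evenCycleProb (2 * k - j)) =
        ∑ i ∈ Finset.range (k + 1), ((2 * k).choose (2 * i) : ℝ) *
          (evenCycleProb (2 * i) * evenCycleProb (2 * k - 2 * i)) := by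
      symm
      refine Finset.sum_of_injOn (fun i => 2 * i) ?_ ?_ ?_ ?_
      · intro a _ b _ h
        simpa using h
      · intro a ha
        simp only [Finset.coe_range, Set.mem_Iio] at ha ⊢
        omega
      · intro j hj hj'
        obtain ⟨i, rfl | rfl⟩ := Nat.even_or_odd' j
        · refine absurd ⟨i, ?_, rfl⟩ hj'
          simp only [Finset.coe_range, Set.mem_Iio, Finset.mem_range] at hj ⊢
          omega
        · rw [evenCycleProb_odd, zero_mul, mul_zero]
      · intro i _
        rfl
    have h2 : ∀ i ∈ Finset.range (k + 1), ((2 * k).choose (2 * i) : ℝ) *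
          (evenCycleProb (2 * i) * evenCycleProb (2 * k - 2 * i)) =
          Nat.centralBinom k / 4 ^ k * (k.choose i : ℝ) ^ 2 := by
      intro i hi
      obtain ⟨j, rfl⟩ := Nat.exists_eq_add_of_le (Finset.mem_range_succ_iff.1 hi)
      rw [← Nat.mul_sub, Nat.add_sub_cancel_left, evenCycleProb_even, evenCycleProb_even]
      have h : ((2 * (i + j)).choose (2 * i) : ℝ) * (Nat.centralBinom i * Nat.centralBinom j) =
        Nat.centralBinom (i + j) * (i + j).choose i ^ 2 := by
        exact_mod_cast choose_mul_centralBinom i j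
      rw [div_mul_div_comm, ← pow_add, ← mul_div_assoc, h]
      ring
    have h3 : (∑ i ∈ Finset.range (k + 1), (k.choose i : ℝ) ^ 2) = Nat.centralBinom k := by
      exact_mod_cast Nat.sum_range_choose_sq k
    rw [h1, Finset.sum_congr rfl h2, ← Finset.mul_sum, h3, evenCycleProb_even, pow_mul]
    norm_num
    field_simp
  · rw [evenCycleProb_odd]
    simp only [ne_eq, OfNat.ofNat_ne_zero, not_false_eq_true, zero_pow, mul_zero]
    refine Finset.sum_eq_zero fun j hj => ?_
    have hj' := Finset.mem_range_succ_iff.1 hj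
    obtain ⟨i, rfl | rfl⟩ := Nat.even_or_odd' j
    · rw [show 2 * k + 1 - 2 * i = 2 * (k - i) + 1 by omega, evenCycleProb_odd]
      ring
    · rw [evenCycleProb_odd]
      ring

/-! ### Triangular form in the Walsh basis and the trace formula. -/

section Trace

variable {n : ℕ}

/-- The number of coordinates equal to `true`. -/
def hammingCount (t : Fin n → Bool) : ℕ := ∑ i, (t i).toNat

theorem hammingCount_cons (c : Bool) (t : Fin n → Bool) :
    hammingCount (Fin.cons c t : Fin (n + 1) → Bool) = c.toNat + hammingCount t := by
  simp [hammingCount, Fin.sum_univ_succ]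

/-- Coordinates outside the support of `t` are free; those inside are counted by how many are
`true`. The powers of 2 are arranged to avoid division. -/
theorem sum_overlap (t : Fin n → Bool) (F : ℕ → ℕ → ℝ) :
    2 ^ hammingCount t * ∑ x, F (overlap t x true) (overlap t x false) =
      2 ^ n * ∑ j ∈ Finset.range (hammingCount t + 1),
        ((hammingCount t).choose j : ℝ) * F j (hammingCount t - j) := by
  induction n generalizing F with
  | zero => simp [hammingCount, overlap]
  | succ n ih =>
    obtain ⟨c, t, rfl⟩ : ∃ c t', t = (Fin.cons c t' : Fin (n + 1) → Bool) :=
      ⟨t 0, Fin.tail t, (Fin.cons_self_tail t).symm⟩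
    rw [sum_bool_cons]
    simp only [overlap_cons, hammingCount_cons]
    cases c
    · simp only [Bool.false_eq_true, false_and, if_false, zero_add, Bool.toNat_false, ← two_mul,
        ← Finset.mul_sum]
      rw [mul_left_comm, ih]
      ring
    · have h1 := ih t (fun i j => F i (j + 1))
      have h2 := ih t (fun i j => F (i + 1) j)
      simp only [Bool.toNat_true, add_comm 1 (hammingCount t), Finset.sum_choose_succ_mul]
      simp only [and_false, and_true, if_false, if_true, zero_add, add_comm 1,
        Finset.sum_add_distrib, Bool.true_eq_false, Bool.false_eq_true]
      have h3 : ∑ j ∈ Finset.range (hammingCount t + 1),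
          ((hammingCount t).choose j : ℝ) * F j (hammingCount t + 1 - j) =
          ∑ j ∈ Finset.range (hammingCount t + 1),
          ((hammingCount t).choose j : ℝ) * F j (hammingCount t - j + 1) := by
        refine Finset.sum_congr rfl fun j hj => ?_
        rw [Nat.sub_add_comm (Finset.mem_range_succ_iff.1 hj)]
      rw [h3, pow_succ, pow_succ, mul_add, mul_add]
      linear_combination 2 * h1 + 2 * h2

theorem hammingCount_const_true : hammingCount (fun _ : Fin n => true) = n := by
  simp [hammingCount]

theorem overlap_const_true (x : Fin n → Bool) :
    overlap (fun _ : Fin n => true) x true = hammingCount x := by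
  refine Finset.sum_congr rfl fun i _ => ?_
  cases x i <;> simp

theorem sum_hammingCount (F : ℕ → ℝ) :
    ∑ x : Fin n → Bool, F (hammingCount x) =
      ∑ j ∈ Finset.range (n + 1), (n.choose j : ℝ) * F j := by
  have h := sum_overlap (fun _ : Fin n => true) (fun i _ => F i)
  simp only [hammingCount_const_true, overlap_const_true] at h
  exact mul_left_cancel₀ (by positivity) h

theorem walsh_eq_neg_one_pow (t x : Fin n → Bool) :
    walsh t x = (-1) ^ overlap t x true := by
  rw [overlap, ← Finset.prod_pow_eq_pow_sum]
  refine Finset.prod_congr rfl fun i _ => ?_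
  cases t i <;> cases x i <;> simp [boolSign]

/-- The matrix of Walsh functions. -/
def walshMatrix (n : ℕ) : Matrix (BinaryTuple n) (BinaryTuple n) ℝ := Matrix.of walsh

theorem walshMatrix_mul_self (n : ℕ) :
    walshMatrix n * walshMatrix n =
      (2 : ℝ) ^ n • (1 : Matrix (BinaryTuple n) (BinaryTuple n) ℝ) := by
  ext r t
  have h1 : ∀ i, ∑ b : Bool, boolSign (r i && b) * boolSign (b && t i) =
      if r i = t i then 2 else 0 := by
    intro i
    cases r i <;> cases t i <;> norm_num [boolSign]
  have h2 : (walshMatrix n * walshMatrix n) r t = ∏ i, if r i = t i then (2 : ℝ) else 0 := by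
    simp only [Matrix.mul_apply, walshMatrix, Matrix.of_apply, walsh, ← Finset.prod_mul_distrib,
      ← h1]
    rw [Finset.prod_univ_sum, Fintype.piFinset_univ]
  rw [h2, Matrix.smul_apply, Matrix.one_apply]
  by_cases h : r = t
  · simp [h]
  · obtain ⟨i, hi⟩ := Function.ne_iff.1 h
    rw [Finset.prod_eq_zero (Finset.mem_univ i) (if_neg hi), if_neg h]
    simp

/-- The Burnside kernel in the basis of Walsh functions. -/
noncomputable def walshKernel (n : ℕ) : Matrix (BinaryTuple n) (BinaryTuple n) ℝ :=
  ((2 : ℝ) ^ n)⁻¹ •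
    (walshMatrix n * (burnsideKernel (Equiv.Perm (Fin n)) (BinaryTuple n) * walshMatrix n))

theorem walshKernel_apply (r t : BinaryTuple n) :
    walshKernel n r t = ((2 : ℝ) ^ n)⁻¹ * ∑ x, walsh r x *
      (evenCycleProb (overlap t x false) * evenCycleProb (overlap t x true)) := by
  simp only [walshKernel, Matrix.smul_apply, smul_eq_mul]
  rw [Matrix.mul_apply]
  congr 1
  refine Finset.sum_congr rfl fun x _ => ?_
  rw [← sum_burnsideKernel_mul_walsh, Matrix.mul_apply]
  rfl

theorem overlap_flipAt_right {i : Fin n} {t : Fin n → Bool} (ht : t i = false)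
    (x : Fin n → Bool) (c : Bool) : overlap t (flipAt i x) c = overlap t x c := by
  refine Finset.sum_congr rfl fun j _ => ?_
  by_cases hj : j = i
  · subst hj
    simp [ht]
  · simp [flipAt, hj]

/-- Flipping `x` at a point of `r` outside `t` changes the sign of `walsh r x` but no overlap with
`t`, so the sum cancels. -/
theorem walshKernel_triangular {r t : BinaryTuple n} (h : ¬ r ≤ t) : walshKernel n r t = 0 := by
  obtain ⟨i, hi⟩ : ∃ i, ¬ r i ≤ t i := by simpa [Pi.le_def] using h
  have ht : t i = false := by
    cases h1 : t i <;> simp_all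
  have hr : r i = true := by
    cases h1 : r i <;> simp_all
  rw [walshKernel_apply]
  have hs := sum_flipAt i (fun x => walsh r x *
      (evenCycleProb (overlap t x false) * evenCycleProb (overlap t x true)))
  simp only [overlap_flipAt_right ht, walsh_comm r (flipAt i _), walsh_flipAt, hr] at hs
  simp only [walsh_comm _ r, boolSign, if_true, neg_mul, one_mul, Finset.sum_neg_distrib] at hs
  rw [show (∑ x, walsh r x *
      (evenCycleProb (overlap t x false) * evenCycleProb (overlap t x true))) = 0 by linarith,
    mul_zero]

theorem walshKernel_diag (t : BinaryTuple n) :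
    walshKernel n t t = evenCycleProb (hammingCount t) ^ 2 := by
  -- The Walsh sign can be dropped because `evenCycleProb` vanishes at odd arguments.
  have hsign : ∀ m : ℕ, (-1 : ℝ) ^ m * evenCycleProb m = evenCycleProb m := by
    intro m
    obtain ⟨k, rfl | rfl⟩ := Nat.even_or_odd' m
    · simp
    · simp [evenCycleProb_odd]
  have h := sum_overlap t (fun i j => evenCycleProb i * evenCycleProb j)
  rw [sum_choose_mul_evenCycleProb] at h
  have h1 : ∑ x, evenCycleProb (overlap t x true) * evenCycleProb (overlap t x false) =
      2 ^ n * evenCycleProb (hammingCount t) ^ 2 := by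
    have h2 : (2 : ℝ) ^ hammingCount t ≠ 0 := by positivity
    refine mul_left_cancel₀ h2 ?_
    rw [h]
    ring
  rw [walshKernel_apply]
  have h2 : ∀ x, walsh t x * (evenCycleProb (overlap t x false) * evenCycleProb (overlap t x true))
      = evenCycleProb (overlap t x true) * evenCycleProb (overlap t x false) := by
    intro x
    rw [walsh_eq_neg_one_pow, mul_left_comm, hsign, mul_comm]
  simp only [h2, h1]
  field_simp

theorem walshKernel_pow (m : ℕ) :
    (∀ r t : BinaryTuple n, ¬ r ≤ t → (walshKernel n ^ m) r t = 0) ∧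
      ∀ t : BinaryTuple n, (walshKernel n ^ m) t t = (evenCycleProb (hammingCount t) ^ 2) ^ m := by
  induction m with
  | zero =>
    refine ⟨fun r t h => ?_, fun t => by simp⟩
    rw [pow_zero, Matrix.one_apply_ne]
    rintro rfl
    exact h le_rfl
  | succ m ih =>
    refine ⟨fun r t h => ?_, fun t => ?_⟩
    · rw [pow_succ, Matrix.mul_apply]
      refine Finset.sum_eq_zero fun s _ => ?_
      by_cases h1 : r ≤ s
      · rw [walshKernel_triangular fun h2 => h (h1.trans h2), mul_zero]
      · rw [ih.1 _ _ h1, zero_mul]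
    · rw [pow_succ, Matrix.mul_apply, Finset.sum_eq_single t, ih.2, walshKernel_diag, ← pow_succ]
      · intro s _ hs
        by_cases h1 : t ≤ s
        · rw [walshKernel_triangular fun h2 => hs (le_antisymm h2 h1), mul_zero]
        · rw [ih.1 _ _ h1, zero_mul]
      · simp

theorem walshMatrix_mul_walshKernel_pow (m : ℕ) :
    walshMatrix n * walshKernel n ^ m =
      burnsideKernel (Equiv.Perm (Fin n)) (BinaryTuple n) ^ m * walshMatrix n := by
  have h1 : walshMatrix n * walshKernel n =
      burnsideKernel (Equiv.Perm (Fin n)) (BinaryTuple n) * walshMatrix n := by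
    rw [walshKernel, Matrix.mul_smul, ← mul_assoc, walshMatrix_mul_self, Matrix.smul_mul, one_mul,
      smul_smul, inv_mul_cancel₀ (by positivity), one_smul]
  induction m with
  | zero => simp
  | succ m ih => rw [pow_succ, ← mul_assoc, ih, mul_assoc, h1, ← mul_assoc, pow_succ]

theorem trace_burnsideKernel_pow (n m : ℕ) :
    (burnsideKernel (Equiv.Perm (Fin n)) (BinaryTuple n) ^ m).trace =
      ∑ j ∈ Finset.range (n + 1), (n.choose j : ℝ) * (evenCycleProb j ^ 2) ^ m := by
  have h1 : (walshKernel n ^ m).trace =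
      ∑ j ∈ Finset.range (n + 1), (n.choose j : ℝ) * (evenCycleProb j ^ 2) ^ m := by
    rw [← sum_hammingCount fun j => (evenCycleProb j ^ 2) ^ m]
    exact Finset.sum_congr rfl fun t _ => (walshKernel_pow m).2 t
  rw [← h1]
  -- Multiplying by the Walsh matrix once more gives `2 ^ n` times each trace, by cyclicity.
  have h2 := congrArg (fun M => (walshMatrix n * M).trace)
    (walshMatrix_mul_walshKernel_pow (n := n) m)
  rw [← mul_assoc, walshMatrix_mul_self, Matrix.trace_mul_comm (walshMatrix n), mul_assoc,
    walshMatrix_mul_self] at h2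
  simp only [Matrix.smul_mul, Matrix.mul_smul, one_mul, mul_one, Matrix.trace_smul, smul_eq_mul]
    at h2
  exact (mul_left_cancel₀ (by positivity) h2).symm

/-- The spectral formula for the average chi-square distance. -/
theorem binaryBurnsideChiSquareAvg_eq (n l : ℕ) :
    binaryBurnsideChiSquareAvg n l =
      ∑ j ∈ Finset.range n, (n.choose (j + 1) : ℝ) * (evenCycleProb (j + 1) ^ 2) ^ (2 * l) := by
  rw [binaryBurnsideChiSquareAvg_eq_trace, trace_burnsideKernel_pow, Finset.sum_range_succ']
  simp [evenCycleProb]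

end Trace

/-! ### Bounds on the eigenvalues and on the distance for fixed `n`. -/

theorem evenCycleProb_sq_le (m : ℕ) : evenCycleProb m ^ 2 ≤ 1 / (m + 1) := by
  induction m using Nat.twoStepInduction with
  | zero => simp [evenCycleProb]
  | one => norm_num [evenCycleProb]
  | more m ih _ =>
    rw [evenCycleProb, mul_pow]
    refine (mul_le_mul_of_nonneg_left ih (by positivity)).trans ?_
    push_cast
    rw [div_pow, div_mul_div_comm, div_le_div_iff₀ (by positivity) (by positivity)]
    nlinarith [sq_nonneg ((m : ℝ) + 1)]

theorem le_evenCycleProb_sq (k : ℕ) :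
    1 / (2 * (2 * k + 2) : ℝ) ≤ evenCycleProb (2 * k + 2) ^ 2 := by
  induction k with
  | zero => norm_num [evenCycleProb]
  | succ k ih =>
    rw [show 2 * (k + 1) + 2 = 2 * k + 2 + 2 by ring, evenCycleProb, mul_pow]
    refine le_trans ?_ (mul_le_mul_of_nonneg_left ih (by positivity))
    push_cast
    rw [div_pow, div_mul_div_comm, div_le_div_iff₀ (by positivity) (by positivity)]
    have : (0 : ℝ) ≤ k := by positivity
    nlinarith

/-- The weight is twice the indicator of even indices; the index 0 is left out, whence the `- 2`. -/
theorem sum_choose_mul_one_add_neg_one_pow {n : ℕ} (hn : n ≠ 0) :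
    ∑ j ∈ Finset.range n, (n.choose (j + 1) : ℝ) * (1 + (-1) ^ (j + 1)) = 2 ^ n - 2 := by
  have h1 := add_pow (1 : ℝ) 1 n
  have h2 := add_pow (-1 : ℝ) 1 n
  rw [Finset.sum_range_succ'] at h1 h2
  simp only [one_pow, mul_one, one_mul, neg_add_cancel, zero_pow hn, pow_zero,
    Nat.choose_zero_right, Nat.cast_one] at h1 h2
  simp only [mul_add, mul_one, Finset.sum_add_distrib, mul_comm (Nat.cast _ : ℝ) ((-1) ^ _)]
  norm_num at h1
  linarith

theorem binaryBurnsideChiSquareAvg_ge {n : ℕ} (hn : n ≠ 0) (l : ℕ) :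
    (2 ^ n / 2 - 1) * (1 / (2 * n) : ℝ) ^ (2 * l) ≤ binaryBurnsideChiSquareAvg n l := by
  have h : (2 ^ n / 2 - 1 : ℝ) = (∑ j ∈ Finset.range n,
      (n.choose (j + 1) : ℝ) * (1 + (-1) ^ (j + 1))) / 2 := by
    rw [sum_choose_mul_one_add_neg_one_pow hn]
    ring
  rw [binaryBurnsideChiSquareAvg_eq, h, Finset.sum_div, Finset.sum_mul]
  refine Finset.sum_le_sum fun j hj => ?_
  rw [mul_div_assoc, mul_assoc]
  refine mul_le_mul_of_nonneg_left ?_ (Nat.cast_nonneg _)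
  have hj' := Finset.mem_range.1 hj
  obtain ⟨k, rfl | rfl⟩ := Nat.even_or_odd' j
  · rw [pow_succ, pow_mul]
    norm_num
    positivity
  · rw [show 2 * k + 1 + 1 = 2 * (k + 1) by ring, pow_mul (-1 : ℝ)]
    norm_num
    refine pow_le_pow_left₀ (by positivity) ?_ _
    refine le_trans ?_ (le_evenCycleProb_sq k)
    rw [show (n : ℝ)⁻¹ * (1 / 2) = 1 / (n * 2) by field_simp]
    refine one_div_le_one_div_of_le (by positivity) ?_
    have : ((2 * k + 1 + 1 : ℕ) : ℝ) ≤ n := by exact_mod_cast hj'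
    push_cast at this
    linarith

/-- The spectrum is split at `M`: up to `M`, at most `n` terms with binomial at most `n ^ M` and
eigenvalue at most `1 / 2`; beyond it, eigenvalues at most `1 / M` with total multiplicity at most
`2 ^ n`. -/
theorem binaryBurnsideChiSquareAvg_le {n : ℕ} (hn : n ≠ 0) (l : ℕ) {M : ℝ} (hM : 0 < M) :
    binaryBurnsideChiSquareAvg n l ≤
      n * Real.exp (M * Real.log n - 2 * l * Real.log 2) +
        2 ^ n * Real.exp (-(2 * l * Real.log M)) := by
  have hn1 : (1 : ℝ) ≤ n := by exact_mod_cast Nat.one_le_iff_ne_zero.2 hn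
  have hn0 : (0 : ℝ) < n := by linarith
  have hpow : ∀ x : ℝ, 0 < x → (1 / x) ^ (2 * l) = Real.exp (-(2 * l * Real.log x)) := by
    intro x hx
    rw [← Real.exp_log (show 0 < (1 / x) ^ (2 * l) by positivity), Real.log_pow, one_div,
      Real.log_inv]
    push_cast
    ring_nf
  have hterm : ∀ j ∈ Finset.range n,
      (n.choose (j + 1) : ℝ) * (evenCycleProb (j + 1) ^ 2) ^ (2 * l) ≤
      Real.exp (M * Real.log n - 2 * l * Real.log 2) +
        (n.choose (j + 1) : ℝ) * Real.exp (-(2 * l * Real.log M)) := by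
    intro j _
    have hg := evenCycleProb_sq_le (j + 1)
    push_cast at hg
    have hj0 : (0 : ℝ) ≤ j := Nat.cast_nonneg j
    by_cases hj : (j : ℝ) + 1 ≤ M
    · refine le_add_of_le_of_nonneg ?_ (by positivity)
      rw [sub_eq_add_neg, Real.exp_add, ← hpow 2 two_pos]
      refine mul_le_mul ?_ ?_ (by positivity) (by positivity)
      · calc (n.choose (j + 1) : ℝ) ≤ (n : ℝ) ^ (j + 1) := by
              exact_mod_cast Nat.choose_le_pow n (j + 1)
          _ = Real.exp (((j : ℝ) + 1) * Real.log n) := by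
              rw [← Real.exp_log (show (0 : ℝ) < (n : ℝ) ^ (j + 1) by positivity), Real.log_pow]
              push_cast
              rfl
          _ ≤ _ := Real.exp_le_exp.2 (mul_le_mul_of_nonneg_right hj (Real.log_nonneg hn1))
      · refine pow_le_pow_left₀ (by positivity) (hg.trans ?_) _
        exact one_div_le_one_div_of_le two_pos (by linarith)
    · refine le_add_of_nonneg_of_le (by positivity) ?_
      refine mul_le_mul_of_nonneg_left ?_ (Nat.cast_nonneg _)
      rw [← hpow M hM]
      refine pow_le_pow_left₀ (by positivity) (hg.trans ?_) _
      exact one_div_le_one_div_of_le hM (by linarith)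
  rw [binaryBurnsideChiSquareAvg_eq]
  refine (Finset.sum_le_sum hterm).trans ?_
  rw [Finset.sum_add_distrib, Finset.sum_const, Finset.card_range, nsmul_eq_mul, ← Finset.sum_mul]
  refine add_le_add_right (mul_le_mul_of_nonneg_right ?_ (Real.exp_pos _).le) _
  have h := Nat.sum_range_choose n
  rw [Finset.sum_range_succ'] at h
  have h' : ∑ j ∈ Finset.range n, n.choose (j + 1) ≤ 2 ^ n := by omega
  exact_mod_cast h'

/-! ### Asymptotics on both sides of the cutoff. -/

theorem tendsto_log_natCast : Tendsto (fun n : ℕ => Real.log n) atTop atTop :=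
  Real.tendsto_log_atTop.comp tendsto_natCast_atTop_atTop

theorem tendsto_log_log_div_log :
    Tendsto (fun n : ℕ => Real.log (Real.log n) / Real.log n) atTop (nhds 0) :=
  (Real.isLittleO_log_id_atTop.tendsto_div_nhds_zero).comp tendsto_log_natCast

theorem tendsto_log_sq_div : Tendsto (fun n : ℕ => Real.log n ^ 2 / n) atTop (nhds 0) :=
  ((Real.isLittleO_pow_log_id_atTop (n := 2)).tendsto_div_nhds_zero).comp tendsto_natCast_atTop_atTop

theorem tendsto_div_log : Tendsto (fun n : ℕ => (n : ℝ) / Real.log n) atTop atTop := by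
  have h : Tendsto (fun n : ℕ => Real.log n / n) atTop (nhdsWithin 0 (Set.Ioi 0)) := by
    refine tendsto_nhdsWithin_iff.2 ⟨(Real.isLittleO_log_id_atTop.tendsto_div_nhds_zero).comp
      tendsto_natCast_atTop_atTop, ?_⟩
    filter_upwards [tendsto_log_natCast.eventually_gt_atTop 0, eventually_gt_atTop 0] with n h1 h2
    exact div_pos h1 (by exact_mod_cast h2)
  refine h.inv_tendsto_nhdsGT_zero.congr fun n => ?_
  simp

theorem tendsto_binaryBurnsideChiSquareAvg_atTop {ε : ℝ} (hε : 0 < ε) {l : ℕ → ℕ}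
    (hl : ∀ᶠ n : ℕ in atTop,
      (l n : ℝ) ≤ (1 - ε) * (Real.log 2 / 2) * ((n : ℝ) / Real.log (n : ℝ))) :
    Tendsto (fun n : ℕ => binaryBurnsideChiSquareAvg n (l n)) atTop atTop := by
  have hlog2 : 0 < Real.log 2 := Real.log_pos one_lt_two
  -- Chosen so that `n * c n` bounds from below the logarithm of `2 ^ n * (1 / (2 * n)) ^ (2 * l
  -- n)`.
  set c : ℕ → ℝ := fun n =>
    Real.log 2 - (1 - ε) * Real.log 2 * (1 + Real.log 2 * (Real.log n)⁻¹)
  have hc : Tendsto c atTop (nhds (ε * Real.log 2)) := by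
    have h1 := (tendsto_inv_atTop_zero.comp tendsto_log_natCast).const_mul (Real.log 2)
    have h2 : Tendsto c atTop (nhds _) :=
      ((h1.const_add 1).const_mul ((1 - ε) * Real.log 2)).const_sub (Real.log 2)
    convert h2 using 2
    ring
  have hlim : Tendsto (fun n : ℕ => Real.exp ((n : ℝ) * c n) * (1 / 4)) atTop atTop :=
    (Real.tendsto_exp_atTop.comp
      (tendsto_natCast_atTop_atTop.atTop_mul_pos (by positivity) hc)).atTop_mul_const (by norm_num)
  refine tendsto_atTop_mono' _ ?_ hlim
  filter_upwards [hl, tendsto_log_natCast.eventually_gt_atTop 0, eventually_ge_atTop 2]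
    with n hn hlog hn2
  have hn0 : (0 : ℝ) < n := by exact_mod_cast (by omega : 0 < n)
  refine le_trans ?_ (binaryBurnsideChiSquareAvg_ge (by omega : n ≠ 0) (l n))
  have h4 : (2 : ℝ) ^ n * (1 / 4) ≤ 2 ^ n / 2 - 1 := by
    have : (2 : ℝ) ^ 2 ≤ 2 ^ n := pow_le_pow_right₀ one_le_two hn2
    linarith
  refine le_trans ?_ (mul_le_mul_of_nonneg_right h4 (by positivity))
  rw [mul_right_comm]
  refine mul_le_mul_of_nonneg_right ?_ (by norm_num)
  rw [← Real.exp_log (show 0 < (2 : ℝ) ^ n * (1 / (2 * n)) ^ (2 * l n) by positivity),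
    Real.exp_le_exp, Real.log_mul (by positivity) (by positivity), Real.log_pow, Real.log_pow,
    one_div, Real.log_inv, Real.log_mul two_ne_zero hn0.ne']
  have h5 := mul_le_mul_of_nonneg_right hn (by positivity : 0 ≤ 2 * (Real.log 2 + Real.log n))
  have h6 : (1 - ε) * (Real.log 2 / 2) * ((n : ℝ) / Real.log n) *
      (2 * (Real.log 2 + Real.log n)) =
      n * ((1 - ε) * Real.log 2 * (1 + Real.log 2 * (Real.log n)⁻¹)) := by
    field_simp
    ring
  rw [h6] at h5
  simp only [c, mul_sub]
  push_cast
  linarith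

theorem tendsto_binaryBurnsideChiSquareAvg_zero {ε : ℝ} (hε : 0 < ε) {l : ℕ → ℕ}
    (hl : ∀ᶠ n : ℕ in atTop,
      (1 + ε) * (Real.log 2 / 2) * ((n : ℝ) / Real.log (n : ℝ)) ≤ (l n : ℝ)) :
    Tendsto (fun n : ℕ => binaryBurnsideChiSquareAvg n (l n)) atTop (nhds 0) := by
  have hlog2 : 0 < Real.log 2 := Real.log_pos one_lt_two
  -- `c` and `d` are the exponential rates of the small-index and large-index parts, at scales `n /
  -- log n` and `n`.
  set c : ℕ → ℝ := fun n => (1 + ε) * Real.log 2 ^ 2 - (Real.log n)⁻¹ - Real.log n ^ 2 / n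
  have hc : Tendsto c atTop (nhds ((1 + ε) * Real.log 2 ^ 2)) := by
    have h := ((tendsto_inv_atTop_zero.comp tendsto_log_natCast).const_sub
      ((1 + ε) * Real.log 2 ^ 2)).sub tendsto_log_sq_div
    simpa using h
  set d : ℕ → ℝ := fun n =>
    (1 + ε) * Real.log 2 * (1 - 3 * (Real.log (Real.log n) / Real.log n)) - Real.log 2
  have hd : Tendsto d atTop (nhds (ε * Real.log 2)) := by
    have h : Tendsto d atTop (nhds _) :=
      ((((tendsto_log_log_div_log.const_mul 3).const_sub 1).const_mul
      ((1 + ε) * Real.log 2))).sub_const (Real.log 2)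
    convert h using 2
    ring
  have hlim1 : Tendsto (fun n : ℕ => Real.exp (-((n : ℝ) / Real.log n * c n))) atTop (nhds 0) :=
    Real.tendsto_exp_neg_atTop_nhds_zero.comp (tendsto_div_log.atTop_mul_pos (by positivity) hc)
  have hlim2 : Tendsto (fun n : ℕ => Real.exp (-((n : ℝ) * d n))) atTop (nhds 0) :=
    Real.tendsto_exp_neg_atTop_nhds_zero.comp
      (tendsto_natCast_atTop_atTop.atTop_mul_pos (by positivity) hd)
  have hlim := hlim1.add hlim2
  rw [add_zero] at hlim
  refine squeeze_zero' (Eventually.of_forall fun n => ?_) ?_ hlim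
  · rw [binaryBurnsideChiSquareAvg_eq]
    positivity
  have hd1 : ∀ᶠ n : ℕ in atTop, 3 * (Real.log (Real.log n) / Real.log n) < 1 := by
    have h := tendsto_log_log_div_log.const_mul 3
    rw [mul_zero] at h
    exact h.eventually_lt_const one_pos
  filter_upwards [hl, tendsto_log_natCast.eventually_gt_atTop 0, eventually_ge_atTop 2, hd1]
    with n hn hlog hn2 hsmall
  have hn0 : (0 : ℝ) < n := by exact_mod_cast (by omega : 0 < n)
  -- The cutoff `M = n / log n ^ 3` makes `M * log n` negligible against `n / log n`, while `log M`
  -- is still asymptotic to `log n`.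
  refine (binaryBurnsideChiSquareAvg_le (by omega : n ≠ 0) (l n)
    (show 0 < (n : ℝ) / Real.log n ^ 3 by positivity)).trans (add_le_add ?_ ?_)
  · rw [← Real.exp_log hn0, ← Real.exp_add, Real.exp_log hn0, Real.exp_le_exp]
    have h5 := mul_le_mul_of_nonneg_right hn (by positivity : 0 ≤ 2 * Real.log 2)
    have h6 : (n : ℝ) / Real.log n * c n =
        (1 + ε) * (Real.log 2 / 2) * ((n : ℝ) / Real.log n) * (2 * Real.log 2) -
          n / Real.log n ^ 3 * Real.log n - Real.log n := by
      simp only [c]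
      field_simp
    rw [h6]
    linarith
  · rw [← Real.exp_log (show (0 : ℝ) < 2 ^ n by positivity), ← Real.exp_add, Real.exp_le_exp,
      Real.log_pow, Real.log_div hn0.ne' (by positivity), Real.log_pow]
    -- Nonnegativity of `log M` is needed to multiply the lower bound on `l n` by it.
    have h1 : 0 ≤ 2 * (Real.log n - 3 * Real.log (Real.log n)) := by
      rw [← mul_div_assoc, div_lt_one hlog] at hsmall
      linarith
    have h5 := mul_le_mul_of_nonneg_right hn h1
    have h6 : (n : ℝ) * d n = (1 + ε) * (Real.log 2 / 2) * ((n : ℝ) / Real.log n) *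
        (2 * (Real.log n - 3 * Real.log (Real.log n))) - n * Real.log 2 := by
      simp only [d]
      field_simp
    rw [h6]
    push_cast
    linarith

theorem theorem4p2 (ε : ℝ) (hε : 0 < ε) :
    (∀ l : ℕ → ℕ,
      (∀ᶠ n : ℕ in atTop,
        (l n : ℝ) ≤ (1 - ε) * (Real.log 2 / 2) * ((n : ℝ) / Real.log (n : ℝ))) →
      Tendsto (fun n : ℕ => binaryBurnsideChiSquareAvg n (l n)) atTop atTop) ∧
    (∀ l : ℕ → ℕ,
      (∀ᶠ n : ℕ in atTop,
        (1 + ε) * (Real.log 2 / 2) * ((n : ℝ) / Real.log (n : ℝ)) ≤ (l n : ℝ)) →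
      Tendsto (fun n : ℕ => binaryBurnsideChiSquareAvg n (l n)) atTop (nhds 0)) :=
  ⟨fun _ hl => tendsto_binaryBurnsideChiSquareAvg_atTop hε hl,
    fun _ hl => tendsto_binaryBurnsideChiSquareAvg_zero hε hl⟩
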